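/- For a real parameter $a\ge 0$ consider the second order, second degree ordinary differential equation ($\sigma$-form of Painlevé V) $$x^2(\tau'')^2-4(x\tau'-\tau)(\tau')^2-4a^2(\tau')^2+4(x\tau'-\tau)^2=0 \qquad (1)$$ together with the boundary condition $$\tau(x)\sim\frac{(x/2)^{2a+1}}{\Gamma(a+\tfrac12)\,\Gamma(a+\tfrac32)}\qquad (x\to 0^+). \qquad (2)$$ Let $b>0$, let $\tau_0$ be a real analytic solution on $(0,b)$ of (1)-(2) with $a=0$ (so that $\tau_0(x)\sim x/\pi$) which is not the degenerate linear solution $\tau_0(x)= x/\pi$, and let $\tau_1$ be a real analytic solution on $(0,b)$ of (1)-(2) with $a=1$ (so that $\tau_1(x)\sim x^3/(3\pi)$). Then for every $x\in(0,b)$ one has $\tau_0(x)\neq 0$ and $$\tau_1(x)=1+\tau_0(x)-x\,\frac{\tau_0'(x)}{\tau_0(x)}.$$ -/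

import Mathlib

open Filter Topology Asymptotics

/-- Left-hand side of the `σ`-form Painlevé V equation
`x² (τ'')² - 4 (x τ' - τ) (τ')² - 4 a² (τ')² + 4 (x τ' - τ)² = 0`. -/
noncomputable def sigmaPVLhs (a : ℝ) (τ : ℝ → ℝ) (x : ℝ) : ℝ :=
  x ^ 2 * (deriv (deriv τ) x) ^ 2
    - 4 * (x * deriv τ x - τ x) * (deriv τ x) ^ 2
    - 4 * a ^ 2 * (deriv τ x) ^ 2
    + 4 * (x * deriv τ x - τ x) ^ 2

/-- The leading small-`x` behaviour `(x/2)^(2a+1) / (Γ(a+1/2) Γ(a+3/2))`. -/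
noncomputable def sigmaPVLeading (a : ℝ) (x : ℝ) : ℝ :=
  (x / 2) ^ (2 * a + 1) / (Real.Gamma (a + 1 / 2) * Real.Gamma (a + 3 / 2))

/-- `τ` is a (real analytic) solution on `(0, b)` of the `σ`-form Painlevé V equation with
parameter `a`, with the prescribed leading behaviour as `x → 0⁺`. -/
structure IsScaledGapSolution (a b : ℝ) (τ : ℝ → ℝ) : Prop where
  analytic : AnalyticOnNhd ℝ τ (Set.Ioo 0 b)
  ode : ∀ x ∈ Set.Ioo 0 b, sigmaPVLhs a τ x = 0
  boundary : τ ~[𝓝[>] 0] sigmaPVLeading a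

/-!
Write `u = x τ' - τ` and `p = τ / x`. Then `p' = u / x²`, `u' = x τ''`, and the equation reads
`u'² = 4 (u + a²) τ'² - 4 u²`. Differentiating and cancelling `τ''` (which is not identically
zero for the solutions considered, so analyticity permits the cancellation) gives the third order
equation `u'' = 2 τ'² + 4 (u + a²) τ' / x - 4 u`.

The function `F = 1 + τ₀ - x τ₀' / τ₀` is shown to be an analytic solution for `a = 1` with the
boundary behaviour `x³ / (3π)` (`IsScaledGapSolution.backlund`), and such a solution is unique
(`IsScaledGapSolution.eqOn_of_one`).

*The transformation.* For `a = 0` the equation forces `u ≥ 0`, so `p` increases from `1 / π` and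
`τ₀ > 0`. That `F` satisfies the equation is an algebraic identity modulo the second and third
order equations (`backlund_identity`). Since `F = H / τ₀` with `H = τ₀² - u`, its boundary
behaviour amounts to `H ~ x⁴ / (3π²)`. The a priori bound `0 ≤ u ≤ τ₀²` comes from
`|(√u)'| ≤ τ₀'` together with the integrability of `p' = u / x²`; the linear equation for `H''`
then improves the resulting bound on `H` to the asymptotics by repeated integration
(`IsScaledGapSolution.tendsto_sq_sub_clairautDefect_div`).

*Uniqueness.* For `a = 1` the boundary condition concerns `τ` only, and derivatives are controlled
as follows: near `0` the function `u` has no critical point with `u ≥ 0`, hence no nonnegative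
local maximum, which forces `u` to be positive and increasing; its size is then read off from
`∫ u / x² = O(x²)`, and `τ' = O(x²)`, `τ'' = O(x)` follow
(`IsScaledGapSolution.exists_bounds_one`). The derivative `w` of the difference of two solutions
satisfies `x (x w')' - 4 w = O(x²) w` with indicial exponents `±2`: the exponent `-2` is excluded
by these bounds and `2` by the common boundary behaviour. So `w` vanishes near `0`
(`exists_eq_zero_of_indicial`), and analytic continuation gives equality on `(0, b)`.
-/

/-! ### Functions near the left end point of an interval -/

theorem tendsto_const_mul_pow_nhdsGT_zero (K : ℝ) {n : ℕ} (hn : n ≠ 0) :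
    Tendsto (fun x : ℝ => K * x ^ n) (𝓝[>] 0) (𝓝 0) := by
  have : ContinuousAt (fun y : ℝ => K * y ^ n) 0 := by fun_prop
  simpa [hn] using this.tendsto.mono_left (nhdsWithin_le_nhds (s := Set.Ioi 0))

theorem tendsto_zero_of_tendsto_div_pow {f : ℝ → ℝ} {c : ℝ} {n : ℕ} (hn : n ≠ 0)
    (h : Tendsto (fun x => f x / x ^ n) (𝓝[>] 0) (𝓝 c)) : Tendsto f (𝓝[>] 0) (𝓝 0) := by
  have := h.mul (tendsto_const_mul_pow_nhdsGT_zero 1 hn)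
  rw [mul_zero] at this
  refine this.congr' ?_
  filter_upwards [self_mem_nhdsWithin] with x hx
  rw [one_mul, div_mul_cancel₀ _ (pow_pos hx n).ne']

/-- Integration of a power bound from the left end point: if `f → 0` at `0⁺` and
`|f' x| ≤ K xⁿ`, then `|f x| ≤ K xⁿ⁺¹ / (n + 1)`. -/
theorem abs_le_of_abs_deriv_le_pow {f f' : ℝ → ℝ} {r K : ℝ} {n : ℕ}
    (hf : ∀ x ∈ Set.Ioo 0 r, HasDerivAt f (f' x) x)
    (h0 : Tendsto f (𝓝[>] 0) (𝓝 0))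
    (hb : ∀ x ∈ Set.Ioo 0 r, |f' x| ≤ K * x ^ n) :
    ∀ x ∈ Set.Ioo 0 r, |f x| ≤ K / (n + 1) * x ^ (n + 1) := by
  have hn : (n : ℝ) + 1 ≠ 0 := by positivity
  have key : ∀ g g' : ℝ → ℝ, (∀ x ∈ Set.Ioo 0 r, HasDerivAt g (g' x) x) →
      Tendsto g (𝓝[>] 0) (𝓝 0) → (∀ x ∈ Set.Ioo 0 r, g' x ≤ K * x ^ n) →
      ∀ x ∈ Set.Ioo 0 r, g x ≤ K / (n + 1) * x ^ (n + 1) := by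
    intro g g' hg hg0 hgb x hx
    have hP : ∀ y, HasDerivAt (fun y : ℝ => K / (n + 1) * y ^ (n + 1)) (K * y ^ n) y := by
      intro y
      have := (hasDerivAt_pow (n + 1) y).const_mul (K / (n + 1))
      refine this.congr_deriv ?_
      simp only [Nat.add_sub_cancel, Nat.cast_add, Nat.cast_one]
      field_simp
    have hd : ∀ y ∈ Set.Ioo 0 r, HasDerivAt (fun y : ℝ => K / (n + 1) * y ^ (n + 1) - g y)
        (K * y ^ n - g' y) y := fun y hy => (hP y).sub (hg y hy)
    have hm : MonotoneOn (fun y : ℝ => K / (n + 1) * y ^ (n + 1) - g y) (Set.Ioo 0 r) := by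
      apply monotoneOn_of_deriv_nonneg (convex_Ioo 0 r)
      · exact fun y hy => (hd y hy).continuousAt.continuousWithinAt
      · rw [interior_Ioo]
        exact fun y hy => (hd y hy).differentiableAt.differentiableWithinAt
      · rw [interior_Ioo]
        intro y hy
        rw [(hd y hy).deriv]
        linarith [hgb y hy]
    have hl : Tendsto (fun y : ℝ => K / (n + 1) * y ^ (n + 1) - g y) (𝓝[>] 0) (𝓝 0) := by
      simpa using (tendsto_const_mul_pow_nhdsGT_zero (K / (n + 1)) n.succ_ne_zero).sub hg0
    have := le_of_tendsto hl (b := K / (n + 1) * x ^ (n + 1) - g x) (by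
      filter_upwards [Ioo_mem_nhdsGT hx.1] with y hy
      exact hm ⟨hy.1, hy.2.trans hx.2⟩ hx hy.2.le)
    linarith
  intro x hx
  rw [abs_le]
  constructor
  · have := key (fun x => -f x) (fun x => -f' x) (fun x hx => (hf x hx).neg)
      (by simpa using h0.neg) (fun x hx => (neg_le_abs _).trans (hb x hx)) x hx
    linarith
  · exact key f f' hf h0 (fun x hx => (le_abs_self _).trans (hb x hx)) x hx

/-- A function on `(0, r)` whose derivative is `O(x)` has a limit at `0⁺`. -/
theorem exists_tendsto_of_abs_deriv_le {f f' : ℝ → ℝ} {r K : ℝ} (hr : 0 < r)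
    (hf : ∀ x ∈ Set.Ioo 0 r, HasDerivAt f (f' x) x)
    (hb : ∀ x ∈ Set.Ioo 0 r, |f' x| ≤ K * x)
    {B : ℝ} (hB : ∀ x ∈ Set.Ioo 0 r, |f x| ≤ B) :
    ∃ c, Tendsto f (𝓝[>] 0) (𝓝 c) := by
  have hK : 0 ≤ K := by
    have h := hb (r / 2) ⟨by linarith, by linarith⟩
    by_contra hneg
    have := abs_nonneg (f' (r / 2))
    nlinarith
  have hd : ∀ y ∈ Set.Ioo 0 r, HasDerivAt (fun y : ℝ => f y + K / 2 * y ^ 2)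
      (f' y + K * y) y := by
    intro y hy
    refine ((hf y hy).add ((hasDerivAt_pow 2 y).const_mul (K / 2))).congr_deriv ?_
    norm_num
    ring
  have hm : MonotoneOn (fun y : ℝ => f y + K / 2 * y ^ 2) (Set.Ioo 0 r) := by
    apply monotoneOn_of_deriv_nonneg (convex_Ioo 0 r)
    · exact fun y hy => (hd y hy).continuousAt.continuousWithinAt
    · rw [interior_Ioo]
      exact fun y hy => (hd y hy).differentiableAt.differentiableWithinAt
    · rw [interior_Ioo]
      intro y hy
      rw [(hd y hy).deriv]
      linarith [neg_abs_le (f' y), hb y hy]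
  have hbdd : BddBelow ((fun y : ℝ => f y + K / 2 * y ^ 2) '' Set.Ioo 0 r) := by
    refine ⟨-B, ?_⟩
    rintro _ ⟨y, hy, rfl⟩
    have := neg_abs_le (f y)
    have := hB y hy
    have : 0 ≤ K / 2 * y ^ 2 := by positivity
    simp only
    linarith
  have hl := hm.tendsto_nhdsWithin_Ioo_right ⟨r / 2, by constructor <;> linarith⟩ hbdd
  refine ⟨sInf ((fun y : ℝ => f y + K / 2 * y ^ 2) '' Set.Ioo 0 r), ?_⟩
  have := hl.sub (tendsto_const_mul_pow_nhdsGT_zero (K / 2) two_ne_zero)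
  simpa using this

theorem tendsto_zero_of_abs_le_mul {f : ℝ → ℝ} {r K : ℝ} (hr : 0 < r)
    (hb : ∀ x ∈ Set.Ioo 0 r, |f x| ≤ K * x) : Tendsto f (𝓝[>] 0) (𝓝 0) := by
  have h2 : Tendsto (fun y : ℝ => K * y) (𝓝[>] 0) (𝓝 0) := by
    simpa using tendsto_const_mul_pow_nhdsGT_zero K one_ne_zero
  apply squeeze_zero_norm' _ h2
  filter_upwards [Ioo_mem_nhdsGT hr] with y hy
  exact hb y hy

theorem exists_forall_Ioo_of_eventually {P : ℝ → Prop} {b : ℝ} (hb : 0 < b)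
    (h : ∀ᶠ x in 𝓝[>] (0 : ℝ), P x) : ∃ r > 0, r ≤ b ∧ ∀ x ∈ Set.Ioo 0 r, P x := by
  obtain ⟨r, hr, hP⟩ := mem_nhdsGT_iff_exists_Ioo_subset.1 h
  exact ⟨min r b, lt_min hr hb, min_le_right _ _,
    fun x hx => hP ⟨hx.1, hx.2.trans_le (min_le_left _ _)⟩⟩

/-! ### The Clairaut defect of a solution -/

/-- The combination `x τ' - τ`, in which the `σ`-form of Painlevé V becomes
`u'² = 4 (u + a²) τ'² - 4 u²`. -/
noncomputable def clairautDefect (τ : ℝ → ℝ) (x : ℝ) : ℝ := x * deriv τ x - τ x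

namespace IsScaledGapSolution

variable {a b : ℝ} {τ : ℝ → ℝ}

theorem hasDerivAt (h : IsScaledGapSolution a b τ) {x : ℝ} (hx : x ∈ Set.Ioo 0 b) :
    HasDerivAt τ (deriv τ x) x :=
  (h.analytic x hx).differentiableAt.hasDerivAt

theorem hasDerivAt_deriv (h : IsScaledGapSolution a b τ) {x : ℝ} (hx : x ∈ Set.Ioo 0 b) :
    HasDerivAt (deriv τ) (deriv (deriv τ) x) x :=
  (h.analytic.deriv x hx).differentiableAt.hasDerivAt

theorem hasDerivAt_clairautDefect (h : IsScaledGapSolution a b τ) {x : ℝ}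
    (hx : x ∈ Set.Ioo 0 b) :
    HasDerivAt (clairautDefect τ) (x * deriv (deriv τ) x) x := by
  have := ((hasDerivAt_id x).mul (h.hasDerivAt_deriv hx)).sub (h.hasDerivAt hx)
  refine this.congr_deriv ?_
  simp

theorem hasDerivAt_div_id (h : IsScaledGapSolution a b τ) {x : ℝ} (hx : x ∈ Set.Ioo 0 b) :
    HasDerivAt (fun y => τ y / y) (clairautDefect τ x / x ^ 2) x := by
  have := (h.hasDerivAt hx).div (hasDerivAt_id x) hx.1.ne'
  refine this.congr_deriv ?_
  simp [clairautDefect]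
  ring

theorem sq_deriv_clairautDefect (h : IsScaledGapSolution a b τ) {x : ℝ}
    (hx : x ∈ Set.Ioo 0 b) :
    (x * deriv (deriv τ) x) ^ 2 =
      4 * (clairautDefect τ x + a ^ 2) * deriv τ x ^ 2 - 4 * clairautDefect τ x ^ 2 := by
  have := h.ode x hx
  simp only [sigmaPVLhs, clairautDefect] at *
  linear_combination this

/-- For a nonlinear solution, differentiating the equation and cancelling `2 x τ''` gives
a third order equation that is linear in the highest derivative. -/
theorem hasDerivAt_mul_deriv_deriv (h : IsScaledGapSolution a b τ)
    (hlin : ∃ x ∈ Set.Ioo 0 b, deriv (deriv τ) x ≠ 0) {x : ℝ} (hx : x ∈ Set.Ioo 0 b) :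
    HasDerivAt (fun y => y * deriv (deriv τ) y)
      (2 * deriv τ x ^ 2 + 4 * (clairautDefect τ x + a ^ 2) * deriv τ x / x
        - 4 * clairautDefect τ x) x := by
  have hA1 := h.analytic.deriv
  have hA2 := hA1.deriv
  have hid : AnalyticOnNhd ℝ (fun y : ℝ => y) (Set.Ioo 0 b) := analyticOnNhd_id
  have hAu : AnalyticOnNhd ℝ (clairautDefect τ) (Set.Ioo 0 b) := (hid.mul hA1).sub h.analytic
  have hAD : AnalyticOnNhd ℝ (fun y => y * deriv (deriv τ) y) (Set.Ioo 0 b) := hid.mul hA2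
  have hD : ∀ y ∈ Set.Ioo 0 b, HasDerivAt (fun y => y * deriv (deriv τ) y)
      (deriv (fun y => y * deriv (deriv τ) y) y) y :=
    fun y hy => (hAD y hy).differentiableAt.hasDerivAt
  set E := deriv (fun y => y * deriv (deriv τ) y) with hE
  have hAE : AnalyticOnNhd ℝ E (Set.Ioo 0 b) := hAD.deriv
  have hprod : ∀ y ∈ Set.Ioo 0 b, deriv (deriv τ) y *
      (y * E y - 2 * y * deriv τ y ^ 2 - 4 * (clairautDefect τ y + a ^ 2) * deriv τ y
        + 4 * y * clairautDefect τ y) = 0 := by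
    intro y hy
    have h1 := (hD y hy).pow 2
    have h2 := ((((h.hasDerivAt_clairautDefect hy).add_const (a ^ 2)).const_mul 4).mul
      ((h.hasDerivAt_deriv hy).pow 2)).sub
        (((h.hasDerivAt_clairautDefect hy).pow 2).const_mul 4)
    have h3 := h1.unique (h2.congr_of_eventuallyEq (by
      filter_upwards [isOpen_Ioo.mem_nhds hy] with z hz
      simpa using h.sq_deriv_clairautDefect hz))
    simp at h3
    linear_combination h3 / 2
  have hA4 : AnalyticOnNhd ℝ (fun y => y * E y - 2 * y * deriv τ y ^ 2
      - 4 * (clairautDefect τ y + a ^ 2) * deriv τ y + 4 * y * clairautDefect τ y)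
      (Set.Ioo 0 b) :=
    (((hid.mul hAE).sub ((analyticOnNhd_const.mul hid).mul (hA1.pow 2))).sub
      ((analyticOnNhd_const.mul (hAu.add analyticOnNhd_const)).mul hA1)).add
      ((analyticOnNhd_const.mul hid).mul hAu)
  rcases hA2.eq_zero_or_eq_zero_of_mul_eq_zero hA4 hprod isPreconnected_Ioo with h0 | h0
  · obtain ⟨y, hy, hne⟩ := hlin
    exact absurd (h0 y hy) hne
  · refine (hD x hx).congr_deriv ?_
    have hx0 := hx.1.ne'
    field_simp
    linear_combination h0 x hx

/-- A solution with vanishing second derivative is affine. -/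
theorem exists_affine_of_deriv_deriv_eq_zero (h : IsScaledGapSolution a b τ)
    (h2 : ∀ x ∈ Set.Ioo 0 b, deriv (deriv τ) x = 0) :
    ∃ c d : ℝ, ∀ x ∈ Set.Ioo 0 b, τ x = c * x + d := by
  by_cases hb : 0 < b
  swap
  · exact ⟨0, 0, fun x hx => absurd (hx.1.trans hx.2) hb⟩
  have hm : b / 2 ∈ Set.Ioo 0 b := ⟨by linarith, by linarith⟩
  have h1 : ∀ x ∈ Set.Ioo 0 b, deriv τ x = deriv τ (b / 2) := fun x hx =>
    isOpen_Ioo.is_const_of_deriv_eq_zero isPreconnected_Ioo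
      (fun y hy => (h.hasDerivAt_deriv hy).differentiableAt.differentiableWithinAt)
      (fun y hy => h2 y hy) hx hm
  refine ⟨deriv τ (b / 2), τ (b / 2) - deriv τ (b / 2) * (b / 2), fun x hx => ?_⟩
  have hd : ∀ y ∈ Set.Ioo 0 b, HasDerivAt (fun y => τ y - deriv τ (b / 2) * y) 0 y := by
    intro y hy
    refine ((h.hasDerivAt hy).sub
      ((hasDerivAt_id y).const_mul (deriv τ (b / 2)))).congr_deriv ?_
    rw [h1 y hy]
    simp
  have := isOpen_Ioo.is_const_of_deriv_eq_zero isPreconnected_Ioo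
      (fun y hy => (hd y hy).differentiableAt.differentiableWithinAt)
      (fun y hy => (hd y hy).deriv) hx hm
  linarith

end IsScaledGapSolution

/-! ### The boundary condition for `a = 0` and `a = 1` -/

theorem Real.Gamma_three_halves : Real.Gamma (3 / 2) = √Real.pi / 2 := by
  rw [show (3 / 2 : ℝ) = 1 / 2 + 1 by norm_num, Real.Gamma_add_one (by norm_num),
    Real.Gamma_one_half_eq]
  ring

theorem sigmaPVLeading_zero (x : ℝ) : sigmaPVLeading 0 x = x / Real.pi := by
  have hs := Real.mul_self_sqrt Real.pi_pos.le
  have hπ := Real.pi_pos.ne'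
  simp only [sigmaPVLeading, mul_zero, zero_add, Real.rpow_one, Real.Gamma_three_halves,
    Real.Gamma_one_half_eq]
  rw [show √Real.pi * (√Real.pi / 2) = Real.pi / 2 by linear_combination hs / 2]
  field_simp

theorem sigmaPVLeading_one (x : ℝ) : sigmaPVLeading 1 x = x ^ 3 / (3 * Real.pi) := by
  have hs := Real.mul_self_sqrt Real.pi_pos.le
  have hπ := Real.pi_pos.ne'
  have h5 : Real.Gamma (1 + 3 / 2) = 3 / 2 * (√Real.pi / 2) := by
    rw [add_comm, Real.Gamma_add_one (by norm_num), Real.Gamma_three_halves]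
  simp only [sigmaPVLeading]
  rw [h5, show (1 : ℝ) + 1 / 2 = 3 / 2 by norm_num, Real.Gamma_three_halves,
    show (2 : ℝ) * 1 + 1 = (3 : ℕ) by norm_num, Real.rpow_natCast,
    show √Real.pi / 2 * (3 / 2 * (√Real.pi / 2)) = 3 * Real.pi / 8 by
      linear_combination 3 * hs / 8]
  field_simp
  norm_num

theorem isEquivalent_sigmaPVLeading_zero_iff {τ : ℝ → ℝ} :
    τ ~[𝓝[>] 0] sigmaPVLeading 0 ↔
      Tendsto (fun x => τ x / x) (𝓝[>] 0) (𝓝 (1 / Real.pi)) := by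
  have hπ := Real.pi_pos.ne'
  have hne : ∀ᶠ x in 𝓝[>] (0 : ℝ), sigmaPVLeading 0 x ≠ 0 := by
    filter_upwards [self_mem_nhdsWithin] with x hx
    have hx : x ≠ 0 := (Set.mem_Ioi.1 hx).ne'
    rw [sigmaPVLeading_zero]
    positivity
  rw [isEquivalent_iff_tendsto_one hne]
  constructor <;> intro h
  · refine Tendsto.congr' ?_ (by simpa using h.mul_const (1 / Real.pi))
    filter_upwards with x
    simp only [sigmaPVLeading_zero]
    field_simp
  · refine Tendsto.congr' ?_ (by simpa [hπ] using h.mul_const Real.pi)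
    filter_upwards with x
    simp only [Pi.div_apply, sigmaPVLeading_zero]
    field_simp

theorem isEquivalent_sigmaPVLeading_one_iff {τ : ℝ → ℝ} :
    τ ~[𝓝[>] 0] sigmaPVLeading 1 ↔
      Tendsto (fun x => τ x / x ^ 3) (𝓝[>] 0) (𝓝 (1 / (3 * Real.pi))) := by
  have h3π : 3 * Real.pi ≠ 0 := by positivity
  have hπ := Real.pi_pos.ne'
  have hne : ∀ᶠ x in 𝓝[>] (0 : ℝ), sigmaPVLeading 1 x ≠ 0 := by
    filter_upwards [self_mem_nhdsWithin] with x hx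
    have hx : x ≠ 0 := (Set.mem_Ioi.1 hx).ne'
    rw [sigmaPVLeading_one]
    positivity
  rw [isEquivalent_iff_tendsto_one hne]
  constructor <;> intro h
  · refine Tendsto.congr' ?_ (by simpa using h.mul_const (1 / (3 * Real.pi)))
    filter_upwards with x
    simp only [sigmaPVLeading_one]
    field_simp
  · refine Tendsto.congr' ?_ 
      (by simpa only [one_div_mul_cancel h3π] using h.mul_const (3 * Real.pi))
    filter_upwards with x
    simp only [Pi.div_apply, sigmaPVLeading_one]
    field_simp

/-! ### Control of the derivatives near zero for `a = 1` -/

namespace IsScaledGapSolution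

variable {a b : ℝ} {τ : ℝ → ℝ}

/-- If `τ / x` has a finite limit at `0⁺`, then `u = x τ' - τ` is not bounded below by a positive
constant there, because `(τ / x)' = u / x²`. -/
theorem not_forall_le_clairautDefect (h : IsScaledGapSolution a b τ) {l : ℝ}
    (hl : Tendsto (fun x => τ x / x) (𝓝[>] 0) (𝓝 l)) {s c : ℝ} (hs : 0 < s) (hsb : s ≤ b)
    (hc : 0 < c) : ¬ ∀ x ∈ Set.Ioo 0 s, c ≤ clairautDefect τ x := by
  intro hu
  have hd : ∀ y ∈ Set.Ioo 0 s, HasDerivAt (fun y : ℝ => τ y / y + c * y⁻¹)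
      (clairautDefect τ y / y ^ 2 + c * -(y ^ 2)⁻¹) y := fun y hy =>
    (h.hasDerivAt_div_id ⟨hy.1, hy.2.trans_le hsb⟩).add
      ((hasDerivAt_inv hy.1.ne').const_mul c)
  have hm : MonotoneOn (fun y : ℝ => τ y / y + c * y⁻¹) (Set.Ioo 0 s) := by
    apply monotoneOn_of_deriv_nonneg (convex_Ioo 0 s)
    · exact fun y hy => (hd y hy).continuousAt.continuousWithinAt
    · rw [interior_Ioo]
      exact fun y hy => (hd y hy).differentiableAt.differentiableWithinAt
    · rw [interior_Ioo]
      intro y hy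
      have hy0 := hy.1
      rw [(hd y hy).deriv, show clairautDefect τ y / y ^ 2 + c * -(y ^ 2)⁻¹ =
        (clairautDefect τ y - c) / y ^ 2 by ring]
      exact div_nonneg (sub_nonneg.2 (hu y hy)) (by positivity)
  have hs2 : s / 2 ∈ Set.Ioo 0 s := ⟨by linarith, by linarith⟩
  have htop : Tendsto (fun y : ℝ => τ y / y + c * y⁻¹) (𝓝[>] 0) atTop :=
    hl.add_atTop (tendsto_inv_nhdsGT_zero.const_mul_atTop hc)
  obtain ⟨y, hy1, hy2⟩ := ((htop.eventually_gt_atTop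
    (τ (s / 2) / (s / 2) + c * (s / 2)⁻¹)).and (Ioo_mem_nhdsGT hs2.1)).exists
  exact absurd (hm ⟨hy2.1, hy2.2.trans hs2.2⟩ hs2 hy2.2.le) (not_le.2 hy1)

/-- Where `τ > 0` and `x < 1`, critical points of `u = x τ' - τ` have `u < 0`. -/
theorem mul_deriv_deriv_ne_zero (h : IsScaledGapSolution 1 b τ) {x : ℝ} (hx : x ∈ Set.Ioo 0 b)
    (hx1 : x < 1) (hτ : 0 < τ x) (hu : 0 ≤ clairautDefect τ x) :
    x * deriv (deriv τ) x ≠ 0 := by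
  intro h0
  have h1 := h.sq_deriv_clairautDefect hx
  rw [h0] at h1
  have hx0 := hx.1
  have h2 : x * deriv τ x = clairautDefect τ x + τ x := by simp [clairautDefect]
  set u := clairautDefect τ x
  set v := deriv τ x
  have hv : 0 < v := pos_of_mul_pos_right (h2 ▸ by linarith) hx0.le
  have huv : u < v := by nlinarith
  nlinarith [mul_nonneg hu (sq_nonneg v), mul_pos (sub_pos.2 huv) hv]

/-- Where `τ > 0` and `x < 1`, once `u = x τ' - τ` is positive it never decreases: otherwise,
having no positive local maximum, `u` would stay above a positive constant down to `0`. -/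
theorem clairautDefect_le_of_lt (h : IsScaledGapSolution 1 b τ) {l : ℝ}
    (hl : Tendsto (fun x => τ x / x) (𝓝[>] 0) (𝓝 l)) {r : ℝ} (hrb : r ≤ b) (hr1 : r ≤ 1)
    (hτ : ∀ x ∈ Set.Ioo 0 r, 0 < τ x) {s t : ℝ} (hs : 0 < s) (hst : s < t) (htr : t < r)
    (hus : 0 < clairautDefect τ s) : clairautDefect τ s ≤ clairautDefect τ t := by
  by_contra! hlt
  refine h.not_forall_le_clairautDefect hl hs (by linarith) hus fun y hy => ?_
  by_contra! hy2
  have hsub : ∀ z ∈ Set.Icc y t, z ∈ Set.Ioo 0 r := fun z hz =>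
    ⟨hy.1.trans_le hz.1, hz.2.trans_lt htr⟩
  have hb : ∀ z ∈ Set.Icc y t, z ∈ Set.Ioo 0 b := fun z hz =>
    ⟨(hsub z hz).1, (hsub z hz).2.trans_le hrb⟩
  obtain ⟨z, hz, hmax⟩ := isCompact_Icc.exists_isMaxOn
    (Set.nonempty_Icc.2 (hy.2.trans hst).le)
    (f := clairautDefect τ) fun z hz =>
      (h.hasDerivAt_clairautDefect (hb z hz)).continuousAt.continuousWithinAt
  have hzs : clairautDefect τ s ≤ clairautDefect τ z := hmax ⟨hy.2.le, hst.le⟩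
  have hzy : y < z := lt_of_le_of_ne hz.1 (by rintro rfl; linarith)
  have hzt : z < t := lt_of_le_of_ne hz.2 (by rintro rfl; linarith)
  exact h.mul_deriv_deriv_ne_zero (hb z hz) ((hsub z hz).2.trans_le hr1) (hτ z (hsub z hz))
    (hus.le.trans hzs)
    ((hmax.isLocalMax (Icc_mem_nhds hzy hzt)).hasDerivAt_eq_zero
      (h.hasDerivAt_clairautDefect (hb z hz)))

theorem clairautDefect_pos (h : IsScaledGapSolution 1 b τ)
    (hl : Tendsto (fun x => τ x / x) (𝓝[>] 0) (𝓝 0)) {r : ℝ} (hrb : r ≤ b) (hr1 : r ≤ 1)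
    (hτ : ∀ x ∈ Set.Ioo 0 r, 0 < τ x) {x : ℝ} (hx : x ∈ Set.Ioo 0 r) :
    0 < clairautDefect τ x := by
  obtain ⟨y, hy1, hy2⟩ := ((hl.eventually_lt_const (div_pos (hτ x hx) hx.1)).and
    (Ioo_mem_nhdsGT hx.1)).exists
  have hb : ∀ z ∈ Set.Icc y x, z ∈ Set.Ioo 0 b := fun z hz =>
    ⟨hy2.1.trans_le hz.1, hz.2.trans_lt (hx.2.trans_le hrb)⟩
  obtain ⟨z, hz, hzd⟩ := exists_hasDerivAt_eq_slope (fun y => τ y / y)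
    (fun y => clairautDefect τ y / y ^ 2) hy2.2
    (fun z hz => (h.hasDerivAt_div_id (hb z hz)).continuousAt.continuousWithinAt)
    (fun z hz => h.hasDerivAt_div_id (hb z (Set.Ioo_subset_Icc_self hz)))
  have hz0 : 0 < z := hy2.1.trans hz.1
  have hpos : 0 < clairautDefect τ z / z ^ 2 := by
    rw [hzd]
    exact div_pos (sub_pos.2 hy1) (sub_pos.2 hy2.2)
  have hzpos : 0 < clairautDefect τ z := by
    have := mul_pos hpos (pow_pos hz0 2)
    rwa [div_mul_cancel₀ _ (pow_pos hz0 2).ne'] at this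
  exact hzpos.trans_le (h.clairautDefect_le_of_lt hl hrb hr1 hτ hz0 hz.2 hx.2 hzpos)

/-- For `a = 1` the relation `τ ~ x³ / (3π)` may be differentiated in the weak sense that
`τ' = O(x²)` and `τ'' = O(x)`. -/
theorem exists_bounds_one (h : IsScaledGapSolution 1 b τ) (hb : 0 < b) :
    ∃ r > 0, r ≤ b ∧ ∀ x ∈ Set.Ioo 0 r, |τ x| ≤ 170 * x ^ 3 ∧ |deriv τ x| ≤ 170 * x ^ 2 ∧
      |x * deriv (deriv τ) x| ≤ 170 * x ^ 2 := by
  have hbd := isEquivalent_sigmaPVLeading_one_iff.1 h.boundary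
  have hπ := Real.pi_gt_three
  have hev : ∀ᶠ x in 𝓝[>] (0 : ℝ), 0 < τ x ∧ τ x ≤ x ^ 3 := by
    filter_upwards [hbd.eventually_const_lt (show (0 : ℝ) < 1 / (3 * Real.pi) by positivity),
      hbd.eventually_lt_const (show 1 / (3 * Real.pi) < (1 : ℝ) by
        rw [div_lt_one (by positivity)]; linarith), self_mem_nhdsWithin] with x h1 h2 hx
    have hx : 0 < x ^ 3 := pow_pos hx 3
    rw [div_lt_one hx] at h2
    exact ⟨(div_pos_iff_of_pos_right hx).1 h1, h2.le⟩
  obtain ⟨r, hr, hrb, hτ⟩ := exists_forall_Ioo_of_eventually (lt_min hb one_pos) hev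
  have hr1 := hrb.trans (min_le_right _ _)
  replace hrb := hrb.trans (min_le_left _ _)
  have hl : Tendsto (fun x => τ x / x) (𝓝[>] 0) (𝓝 0) := by
    apply tendsto_zero_of_abs_le_mul hr (K := 1)
    intro x hx
    have hx0 := hx.1
    have hx1 : x < 1 := hx.2.trans_le hr1
    rw [abs_of_pos (div_pos (hτ x hx).1 hx0), div_le_iff₀ hx0]
    nlinarith [(hτ x hx).2, mul_pos hx0 hx0]
  have hpos := fun x (hx : x ∈ Set.Ioo 0 r) =>
    h.clairautDefect_pos hl hrb hr1 (fun x hx => (hτ x hx).1) hx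
  have hmono := fun s t (hs : 0 < s) (hst : s < t) (ht : t < r) =>
    h.clairautDefect_le_of_lt hl hrb hr1 (fun x hx => (hτ x hx).1) hs hst ht
      (hpos s ⟨hs, hst.trans ht⟩)
  refine ⟨r / 2, by linarith, by linarith, fun x hx => ?_⟩
  have hx0 := hx.1
  have hxr : 2 * x < r := by linarith [hx.2]
  have hx1 : x < 1 / 2 := by linarith
  have hxr' : x ∈ Set.Ioo 0 r := ⟨hx0, by linarith⟩
  have hxb : x ∈ Set.Ioo 0 b := ⟨hx0, by linarith⟩
  -- The mean value of `u / y²` over `[x, 2x]` bounds the monotone function `u` at `x`.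
  have hu : clairautDefect τ x ≤ 16 * x ^ 3 := by
    have hI : ∀ z ∈ Set.Icc x (2 * x), z ∈ Set.Ioo 0 b := fun z hz =>
      ⟨hx0.trans_le hz.1, by linarith [hz.2]⟩
    obtain ⟨z, hz, hzd⟩ := exists_hasDerivAt_eq_slope (fun y => τ y / y)
      (fun y => clairautDefect τ y / y ^ 2) (show x < 2 * x by linarith)
      (fun z hz => (h.hasDerivAt_div_id (hI z hz)).continuousAt.continuousWithinAt)
      (fun z hz => h.hasDerivAt_div_id (hI z (Set.Ioo_subset_Icc_self hz)))
    have hz0 : 0 < z := hx0.trans hz.1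
    have h1 : τ (2 * x) / (2 * x) ≤ 4 * x ^ 2 := by
      rw [div_le_iff₀ (by linarith)]
      nlinarith [(hτ (2 * x) ⟨by linarith, hxr⟩).2]
    have h2 : 0 < τ x / x := div_pos (hτ x hxr').1 hx0
    have h3 : clairautDefect τ z / z ^ 2 ≤ 4 * x := by
      rw [hzd, div_le_iff₀ (by linarith)]
      nlinarith
    rw [div_le_iff₀ (by positivity)] at h3
    have h4 := hmono x z hx0 hz.1 (by linarith [hz.2])
    have h5 : z ^ 2 ≤ (2 * x) ^ 2 := pow_le_pow_left₀ hz0.le hz.2.le 2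
    nlinarith
  have hu0 := hpos x hxr'
  have hτx := hτ x hxr'
  have hv : x * deriv τ x = clairautDefect τ x + τ x := by simp [clairautDefect]
  have hv0 : 0 < deriv τ x := pos_of_mul_pos_right (hv ▸ by linarith [hτx.1]) hx0.le
  have hv1 : deriv τ x ≤ 17 * x ^ 2 := by
    have : x * deriv τ x ≤ x * (17 * x ^ 2) := by linarith [hτx.2]
    exact le_of_mul_le_mul_left this hx0
  have hx3 : x ^ 3 ≤ 1 / 8 := by
    have := pow_le_pow_left₀ hx0.le hx1.le 3
    norm_num at this ⊢
    exact this
  refine ⟨?_, ?_, ?_⟩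
  · rw [abs_of_pos hτx.1]
    nlinarith [hτx.2, pow_pos hx0 3]
  · rw [abs_of_pos hv0]
    nlinarith [pow_pos hx0 2]
  · apply abs_le_of_sq_le_sq _ (by positivity)
    rw [h.sq_deriv_clairautDefect hxb]
    have h6 : deriv τ x ^ 2 ≤ (17 * x ^ 2) ^ 2 := pow_le_pow_left₀ hv0.le hv1 2
    have h7 : clairautDefect τ x + 1 ^ 2 ≤ 3 := by linarith
    calc _ ≤ 4 * (clairautDefect τ x + 1 ^ 2) * deriv τ x ^ 2 := by
          nlinarith [sq_nonneg (clairautDefect τ x)]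
      _ ≤ 4 * 3 * (17 * x ^ 2) ^ 2 := by gcongr
      _ ≤ (170 * x ^ 2) ^ 2 := by nlinarith [sq_nonneg (x ^ 2)]

/-- For `a = 1` the boundary condition excludes affine solutions. -/
theorem exists_deriv_deriv_ne_zero_one (h : IsScaledGapSolution 1 b τ) (hb : 0 < b) :
    ∃ x ∈ Set.Ioo 0 b, deriv (deriv τ) x ≠ 0 := by
  by_contra! h2
  obtain ⟨c, d, hcd⟩ := h.exists_affine_of_deriv_deriv_eq_zero h2
  obtain ⟨r, hr, hrb, hbd⟩ := h.exists_bounds_one hb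
  have hbdy := isEquivalent_sigmaPVLeading_one_iff.1 h.boundary
  have hev : ∀ᶠ x in 𝓝[>] (0 : ℝ), τ x = c * x + d ∧ |c| ≤ 170 * x ^ 2 := by
    filter_upwards [Ioo_mem_nhdsGT hr] with x hx
    have hxb : x ∈ Set.Ioo 0 b := ⟨hx.1, hx.2.trans_le hrb⟩
    refine ⟨hcd x hxb, ?_⟩
    have : deriv τ x = c := by
      have h3 : HasDerivAt (fun y => c * y + d) c x := by
        simpa using ((hasDerivAt_id x).const_mul c).add_const d
      exact (h.hasDerivAt hxb).unique (h3.congr_of_eventuallyEq (by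
        filter_upwards [isOpen_Ioo.mem_nhds hxb] with z hz using hcd z hz))
    rw [← this]
    exact (hbd x hx).2.1
  have h0 := tendsto_const_mul_pow_nhdsGT_zero 170 two_ne_zero
  have hc : c = 0 := abs_nonpos_iff.1 (ge_of_tendsto h0 (hev.mono fun x hx => hx.2))
  have hτ0 := tendsto_zero_of_tendsto_div_pow three_ne_zero hbdy
  have hd : d = 0 := tendsto_nhds_unique (tendsto_const_nhds.congr' (by
    filter_upwards [hev] with x hx
    rw [hx.1, hc]; ring)) hτ0
  have hlim : (0 : ℝ) = 1 / (3 * Real.pi) := tendsto_nhds_unique (tendsto_const_nhds.congr' (by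
    filter_upwards [hev] with x hx
    rw [hx.1, hc, hd]; simp)) hbdy
  have : (0 : ℝ) < 1 / (3 * Real.pi) := by positivity
  linarith

end IsScaledGapSolution

/-! ### Uniqueness for `a = 1` -/

/-- Uniqueness at the regular singular point `0` of `x (x w')' - 4 w = N`, `w = δ'`, `D = x w'`,
whose indicial exponents are `±2`: if the right-hand side is Lipschitz small relative to `w` and
the solution of exponent `2` is excluded by `δ = o(x³)`, then `δ` vanishes near `0`. -/
theorem exists_eq_zero_of_indicial {δ w D E : ℝ → ℝ} {r B K : ℝ} (hr : 0 < r) (hr1 : r ≤ 1)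
    (hK : 0 ≤ K)
    (hδ : ∀ x ∈ Set.Ioo 0 r, HasDerivAt δ (w x) x)
    (hw : ∀ x ∈ Set.Ioo 0 r, HasDerivAt w (D x / x) x)
    (hD : ∀ x ∈ Set.Ioo 0 r, HasDerivAt D (E x) x)
    (hwB : ∀ x ∈ Set.Ioo 0 r, |w x| ≤ B * x ^ 2)
    (hDB : ∀ x ∈ Set.Ioo 0 r, |D x| ≤ B * x ^ 2)
    (hδ3 : Tendsto (fun x => δ x / x ^ 3) (𝓝[>] 0) (𝓝 0))
    (hN : ∀ M, 0 ≤ M → ∀ s ≤ r, (∀ x ∈ Set.Ioo 0 s, |w x| ≤ M * x ^ 2) →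
      ∀ x ∈ Set.Ioo 0 s, |x * E x - 4 * w x| ≤ K * M * x ^ 4) :
    ∃ s > 0, s ≤ r ∧ ∀ x ∈ Set.Ioo 0 s, δ x = 0 := by
  have hB : 0 ≤ B := by
    have h1 := (abs_nonneg _).trans (hwB (r / 2) ⟨by linarith, by linarith⟩)
    have : 0 < (r / 2) ^ 2 := by positivity
    nlinarith
  set ψ : ℝ → ℝ := fun x => (D x + 2 * w x) / x ^ 2
  have hψ : ∀ x ∈ Set.Ioo 0 r, HasDerivAt ψ ((x * E x - 4 * w x) / x ^ 3) x := by
    intro x hx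
    have hx0 := hx.1.ne'
    refine (((hD x hx).add ((hw x hx).const_mul 2)).div (hasDerivAt_pow 2 x)
      (pow_ne_zero 2 hx0)).congr_deriv ?_
    simp only [Pi.add_apply]
    field_simp
    ring
  have hψb : ∀ M, 0 ≤ M → ∀ s ≤ r, (∀ x ∈ Set.Ioo 0 s, |w x| ≤ M * x ^ 2) →
      ∀ x ∈ Set.Ioo 0 s, |(x * E x - 4 * w x) / x ^ 3| ≤ K * M * x := by
    intro M hM s hs hwM x hx
    have hx3 := pow_pos hx.1 3
    rw [abs_div, abs_of_pos hx3, div_le_iff₀ hx3]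
    exact (hN M hM s hs hwM x hx).trans_eq (by ring)
  obtain ⟨c, hc⟩ := exists_tendsto_of_abs_deriv_le hr hψ (hψb B hB r le_rfl hwB) (B := 3 * B)
    (by
      intro x hx
      have hx2 := pow_pos hx.1 2
      rw [abs_div, abs_of_pos hx2, div_le_iff₀ hx2]
      refine (abs_add_le _ _).trans ?_
      rw [abs_mul, abs_two]
      linarith [hwB x hx, hDB x hx])
  have hw2 : ∀ M, 0 ≤ M → ∀ s, 0 < s → s ≤ r → (∀ x ∈ Set.Ioo 0 s, |w x| ≤ M * x ^ 2) →
      ∀ x ∈ Set.Ioo 0 s, |w x - c / 4 * x ^ 2| ≤ K * M * x ^ 4 := by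
    intro M hM s hs0 hs hwM
    have hr' : ∀ x ∈ Set.Ioo 0 s, x ∈ Set.Ioo 0 r := fun x hx => ⟨hx.1, hx.2.trans_le hs⟩
    have h1 : ∀ x ∈ Set.Ioo 0 s, |ψ x - c| ≤ K * M / ((1 : ℕ) + 1) * x ^ (1 + 1) :=
      abs_le_of_abs_deriv_le_pow (f := fun x => ψ x - c)
        (fun x hx => (hψ x (hr' x hx)).sub_const c)
        (by simpa using hc.sub_const c) (fun x hx => by simpa using hψb M hM s hs hwM x hx)
    have h2 := abs_le_of_abs_deriv_le_pow (f := fun x => x ^ 2 * w x - c / 4 * x ^ 4)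
      (f' := fun x => x ^ 3 * (ψ x - c)) (K := K * M / 2) (n := 5) (r := s)
      (by
        intro x hx
        have hx0 := hx.1.ne'
        refine (((hasDerivAt_pow 2 x).mul (hw x (hr' x hx))).sub
          ((hasDerivAt_pow 4 x).const_mul (c / 4))).congr_deriv ?_
        simp only [ψ]
        field_simp
        norm_num
        ring)
      (by
        apply tendsto_zero_of_abs_le_mul hs0 (K := M + |c|)
        intro x hx
        have hx0 := hx.1
        have hx1 : x ≤ 1 := (hr' x hx).2.le.trans hr1
        refine (abs_sub _ _).trans ?_
        rw [abs_mul, abs_mul, abs_div, abs_of_pos (pow_pos hx0 2), abs_of_pos (pow_pos hx0 4)]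
        have h4 : x ^ 4 ≤ x := pow_le_of_le_one hx0.le hx1 (by norm_num)
        have h5 := hwM x hx
        have h6 := abs_nonneg c
        have : x ^ 2 * |w x| ≤ M * x :=
          calc x ^ 2 * |w x| ≤ x ^ 2 * (M * x ^ 2) := by gcongr
            _ = M * x ^ 4 := by ring
            _ ≤ M * x := by gcongr
        have : |c| / |4| * x ^ 4 ≤ |c| * x := by
          apply mul_le_mul _ h4 (by positivity) h6
          norm_num
          linarith
        linarith)
      (by
        intro x hx
        have hx3 := pow_pos hx.1 3
        rw [abs_mul, abs_of_pos hx3]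
        calc x ^ 3 * |ψ x - c| ≤ x ^ 3 * (K * M / ((1 : ℕ) + 1) * x ^ (1 + 1)) := by
              gcongr
              exact h1 x hx
          _ = K * M / 2 * x ^ 5 := by norm_num; ring)
    intro x hx
    have hx2 := pow_pos hx.1 2
    have h3 := h2 x hx
    rw [show x ^ 2 * w x - c / 4 * x ^ 4 = x ^ 2 * (w x - c / 4 * x ^ 2) by ring, abs_mul,
      abs_of_pos hx2] at h3
    refine le_of_mul_le_mul_left (h3.trans ?_) hx2
    have : 0 ≤ K * M * x ^ 6 := by have := hx.1; positivity
    norm_num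
    linarith
  have hδ0 := tendsto_zero_of_tendsto_div_pow three_ne_zero hδ3
  have hc0 : c = 0 := by
    have h1 := abs_le_of_abs_deriv_le_pow (f := fun x => δ x - c / 12 * x ^ 3)
      (f' := fun x => w x - c / 4 * x ^ 2) (K := K * B) (n := 4) (r := r)
      (by
        intro x hx
        refine ((hδ x hx).sub ((hasDerivAt_pow 3 x).const_mul (c / 12))).congr_deriv ?_
        norm_num
        ring)
      (by simpa using hδ0.sub (tendsto_const_mul_pow_nhdsGT_zero (c / 12) three_ne_zero))
      (hw2 B hB r hr le_rfl hwB)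
    have h2 : Tendsto (fun x => δ x / x ^ 3 - c / 12) (𝓝[>] 0) (𝓝 0) := by
      apply tendsto_zero_of_abs_le_mul hr (K := K * B)
      intro x hx
      have hx0 := hx.1
      have hx3 := pow_pos hx0 3
      have hx1 : x ≤ 1 := hx.2.le.trans hr1
      rw [show δ x / x ^ 3 - c / 12 = (δ x - c / 12 * x ^ 3) / x ^ 3 by field_simp, abs_div,
        abs_of_pos hx3, div_le_iff₀ hx3]
      refine (h1 x hx).trans ?_
      have hKB : 0 ≤ K * B := mul_nonneg hK hB
      have : x ^ 5 ≤ x ^ 4 := pow_le_pow_of_le_one hx0.le hx1 (by norm_num)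
      calc K * B / ((4 : ℕ) + 1) * x ^ (4 + 1) ≤ K * B * x ^ 4 := by
            apply mul_le_mul _ this (by positivity) hKB
            norm_num
            linarith
        _ = K * B * x * x ^ 3 := by ring
    have h3 := tendsto_nhds_unique h2 (hδ3.sub_const (c / 12))
    linarith
  -- On `(0, s)` any bound `|w| ≤ M x²` improves to `|w| ≤ (M / 2) x²`.
  set s := min r (1 / (K + 2)) with hs
  have hK2 : 0 < 1 / (K + 2) := by positivity
  have hs0 : 0 < s := lt_min hr hK2
  have hsr : s ≤ r := min_le_left _ _
  have hsK : K * s ^ 2 ≤ 1 / 2 := by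
    have h1 : s ≤ 1 / (K + 2) := min_le_right _ _
    have h2 : s * (K + 2) ≤ 1 := by rwa [le_div_iff₀ (by positivity)] at h1
    nlinarith [mul_nonneg hK hs0.le]
  have hiter : ∀ n : ℕ, ∀ x ∈ Set.Ioo 0 s, |w x| ≤ B * (1 / 2) ^ n * x ^ 2 := by
    intro n
    induction n with
    | zero => simpa using fun x h1 h2 => hwB x ⟨h1, h2.trans_le hsr⟩
    | succ n ih =>
      intro x hx
      have h1 := hw2 _ (by positivity) s hs0 hsr ih x hx
      rw [hc0] at h1
      simp only [zero_div, zero_mul, sub_zero] at h1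
      refine h1.trans ?_
      have h2 : K * x ^ 2 ≤ 1 / 2 := by
        refine le_trans ?_ hsK
        have := hx.1
        gcongr
        exact hx.2.le
      calc K * (B * (1 / 2) ^ n) * x ^ 4 = (K * x ^ 2) * (B * (1 / 2) ^ n * x ^ 2) := by ring
        _ ≤ 1 / 2 * (B * (1 / 2) ^ n * x ^ 2) := by gcongr
        _ = B * (1 / 2) ^ (n + 1) * x ^ 2 := by ring
  have hw0 : ∀ x ∈ Set.Ioo 0 s, w x = 0 := by
    intro x hx
    have h1 : Tendsto (fun n : ℕ => B * (1 / 2 : ℝ) ^ n * x ^ 2) atTop (𝓝 0) := by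
      simpa using ((tendsto_pow_atTop_nhds_zero_of_lt_one (by norm_num : (0 : ℝ) ≤ 1 / 2)
        (by norm_num)).const_mul B).mul_const (x ^ 2)
    exact abs_nonpos_iff.1 (ge_of_tendsto' h1 fun n => hiter n x hx)
  refine ⟨s, hs0, hsr, fun x hx => ?_⟩
  have h1 := abs_le_of_abs_deriv_le_pow (f := δ) (f' := w) (K := 0) (n := 0) (r := s)
    (fun y hy => hδ y ⟨hy.1, hy.2.trans_le hsr⟩)
    hδ0
    (fun y hy => by simp [hw0 y hy]) x hx
  simpa using h1

namespace IsScaledGapSolution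

variable {b : ℝ} {σ ρ : ℝ → ℝ}

/-- The `σ`-form with `a = 1` has at most one analytic solution with the boundary behaviour
`x³ / (3π)`. -/
theorem eqOn_of_one (hσ : IsScaledGapSolution 1 b σ) (hρ : IsScaledGapSolution 1 b ρ) :
    Set.EqOn σ ρ (Set.Ioo 0 b) := by
  by_cases hb : 0 < b
  swap
  · exact fun x hx => absurd (hx.1.trans hx.2) hb
  obtain ⟨r₁, hr₁, hrb₁, hB₁⟩ := hσ.exists_bounds_one hb
  obtain ⟨r₂, hr₂, hrb₂, hB₂⟩ := hρ.exists_bounds_one hb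
  have hE₁ := fun x hx => hσ.hasDerivAt_mul_deriv_deriv (hσ.exists_deriv_deriv_ne_zero_one hb)
    (x := x) hx
  have hE₂ := fun x hx => hρ.hasDerivAt_mul_deriv_deriv (hρ.exists_deriv_deriv_ne_zero_one hb)
    (x := x) hx
  set r := min (min r₁ r₂) 1
  have hr : 0 < r := lt_min (lt_min hr₁ hr₂) one_pos
  have hr1 : r ≤ 1 := min_le_right _ _
  have hI₁ : ∀ x ∈ Set.Ioo 0 r, x ∈ Set.Ioo 0 r₁ := fun x hx =>
    ⟨hx.1, hx.2.trans_le ((min_le_left _ _).trans (min_le_left _ _))⟩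
  have hI₂ : ∀ x ∈ Set.Ioo 0 r, x ∈ Set.Ioo 0 r₂ := fun x hx =>
    ⟨hx.1, hx.2.trans_le ((min_le_left _ _).trans (min_le_right _ _))⟩
  have hI : ∀ x ∈ Set.Ioo 0 r, x ∈ Set.Ioo 0 b := fun x hx =>
    ⟨hx.1, (hI₁ x hx).2.trans_le hrb₁⟩
  have hδ3 : Tendsto (fun x => (σ x - ρ x) / x ^ 3) (𝓝[>] 0) (𝓝 0) := by
    simpa [sub_div] using (isEquivalent_sigmaPVLeading_one_iff.1 hσ.boundary).sub
      (isEquivalent_sigmaPVLeading_one_iff.1 hρ.boundary)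
  have hδ : ∀ x ∈ Set.Ioo 0 r,
      HasDerivAt (fun x => σ x - ρ x) (deriv σ x - deriv ρ x) x := fun x hx =>
    (hσ.hasDerivAt (hI x hx)).sub (hρ.hasDerivAt (hI x hx))
  obtain ⟨s, hs0, hsr, hs⟩ := exists_eq_zero_of_indicial (δ := fun x => σ x - ρ x)
    (w := fun x => deriv σ x - deriv ρ x) (K := 3408) (B := 340)
    (D := fun x => x * deriv (deriv σ) x - x * deriv (deriv ρ) x) hr hr1 (by norm_num) hδ
    (fun x hx => ((hσ.hasDerivAt_deriv (hI x hx)).sub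
      (hρ.hasDerivAt_deriv (hI x hx))).congr_deriv (by have := hx.1.ne'; field_simp))
    (fun x hx => (hE₁ x (hI x hx)).sub (hE₂ x (hI x hx)))
    (fun x hx => (abs_sub _ _).trans (by
      linarith [(hB₁ x (hI₁ x hx)).2.1, (hB₂ x (hI₂ x hx)).2.1]))
    (fun x hx => (abs_sub _ _).trans (by
      linarith [(hB₁ x (hI₁ x hx)).2.2, (hB₂ x (hI₂ x hx)).2.2])) hδ3
    (by
      intro M hM s hsr hw x hx
      have hxr : x ∈ Set.Ioo 0 r := ⟨hx.1, hx.2.trans_le hsr⟩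
      have hx0 := hx.1
      have hx1 : x ≤ 1 := hxr.2.le.trans hr1
      obtain ⟨hs1, hs2, -⟩ := hB₁ x (hI₁ x hxr)
      obtain ⟨-, hp2, -⟩ := hB₂ x (hI₂ x hxr)
      have hs0 : 0 < s := hx0.trans hx.2
      have hd : |σ x - ρ x| ≤ M * x ^ 3 := by
        have h1 := abs_le_of_abs_deriv_le_pow (fun y hy => hδ y ⟨hy.1, hy.2.trans_le hsr⟩)
          (tendsto_zero_of_tendsto_div_pow three_ne_zero hδ3) hw x hx
        refine h1.trans ?_
        have : 0 ≤ M * x ^ 3 := by positivity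
        norm_num
        linarith
      have hwx := hw x hx
      simp only [clairautDefect]
      set v := deriv σ x
      set v' := deriv ρ x
      have hu1 : |x * v - σ x| ≤ 340 * x ^ 3 := by
        refine (abs_sub _ _).trans ?_
        rw [abs_mul, abs_of_pos hx0]
        nlinarith
      have hU : |x * (v - v') - (σ x - ρ x)| ≤ 2 * M * x ^ 3 := by
        refine (abs_sub _ _).trans ?_
        rw [abs_mul, abs_of_pos hx0]
        nlinarith
      have hv : |v + v'| ≤ 340 * x ^ 2 := (abs_add_le _ _).trans (by linarith)
      have heq : x * ((2 * v ^ 2 + 4 * (x * v - σ x + 1 ^ 2) * v / x - 4 * (x * v - σ x)) -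
          (2 * v' ^ 2 + 4 * (x * v' - ρ x + 1 ^ 2) * v' / x - 4 * (x * v' - ρ x)))
          - 4 * (v - v') =
          2 * x * ((v + v') * (v - v')) + 4 * ((x * v - σ x) * (v - v'))
          + 4 * (v' * (x * (v - v') - (σ x - ρ x)))
          - 4 * x * (x * (v - v') - (σ x - ρ x)) := by
        field_simp
        ring
      rw [heq]
      have e1 : |2 * x * ((v + v') * (v - v'))| ≤ 680 * (M * x ^ 5) := by
        rw [abs_mul, abs_mul (v + v'), abs_of_pos (by positivity : 0 < 2 * x)]
        calc _ ≤ 2 * x * ((340 * x ^ 2) * (M * x ^ 2)) := by gcongr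
          _ = _ := by ring
      have e2 : |4 * ((x * v - σ x) * (v - v'))| ≤ 1360 * (M * x ^ 5) := by
        rw [abs_mul, abs_mul (x * v - σ x), abs_of_pos (by norm_num : (0 : ℝ) < 4)]
        calc _ ≤ 4 * ((340 * x ^ 3) * (M * x ^ 2)) := by gcongr
          _ = _ := by ring
      have e3 : |4 * (v' * (x * (v - v') - (σ x - ρ x)))| ≤ 1360 * (M * x ^ 5) := by
        rw [abs_mul, abs_mul v', abs_of_pos (by norm_num : (0 : ℝ) < 4)]
        calc _ ≤ 4 * ((170 * x ^ 2) * (2 * M * x ^ 3)) := by gcongr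
          _ = _ := by ring
      have e4 : |4 * x * (x * (v - v') - (σ x - ρ x))| ≤ 8 * (M * x ^ 4) := by
        rw [abs_mul, abs_of_pos (by positivity : 0 < 4 * x)]
        calc _ ≤ 4 * x * (2 * M * x ^ 3) := by gcongr
          _ = _ := by ring
      have h5 : M * x ^ 5 ≤ M * x ^ 4 := by
        gcongr 1
        exact pow_le_pow_of_le_one hx0.le hx1 (by norm_num)
      refine (abs_sub _ _).trans ?_
      have t1 := abs_add_le (2 * x * ((v + v') * (v - v')) + 4 * ((x * v - σ x) * (v - v')))
        (4 * (v' * (x * (v - v') - (σ x - ρ x))))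
      have t2 := abs_add_le (2 * x * ((v + v') * (v - v'))) (4 * ((x * v - σ x) * (v - v')))
      linarith)
  have hsb : s / 2 ∈ Set.Ioo 0 b := hI _ ⟨by linarith, by linarith⟩
  refine hσ.analytic.eqOn_of_preconnected_of_eventuallyEq hρ.analytic isPreconnected_Ioo hsb ?_
  filter_upwards [Ioo_mem_nhds (show 0 < s / 2 by linarith) (show s / 2 < s by linarith)]
    with x hx
  exact sub_eq_zero.1 (hs x hx)

end IsScaledGapSolution

/-! ### The Bäcklund transformation from `a = 0` to `a = 1` -/

/-- The algebra behind the Bäcklund transformation. Here `t, v, q` stand for `τ, τ', τ''`, and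
`E` for `(x τ'')'`, which is eliminated by the third order equation. -/
theorem backlund_identity {x t v q E : ℝ} (hx : x ≠ 0) (ht : t ≠ 0)
    (hE : E = 2 * v ^ 2 + 4 * (x * v - t) * v / x - 4 * (x * v - t))
    (hode : (x * q) ^ 2 = 4 * (x * v - t) * v ^ 2 - 4 * (x * v - t) ^ 2)
    {F F₁ F₂ : ℝ} (hF : F = 1 + t - x * (v / t))
    (hF₁ : F₁ = v - v / t - x * q / t + x * v ^ 2 / t ^ 2)
    (hF₂ : F₂ = q - q / t + v ^ 2 / t ^ 2 - E / t + x * q * v / t ^ 2 + v ^ 2 / t ^ 2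
      + 2 * x * v * q / t ^ 2 - 2 * x * v ^ 3 / t ^ 3) :
    x ^ 2 * F₂ ^ 2 - 4 * (x * F₁ - F) * F₁ ^ 2 - 4 * F₁ ^ 2 + 4 * (x * F₁ - F) ^ 2 = 0 := by
  -- In terms of `m = x τ' / τ` and `p = x² τ'' / τ` every quantity is a polynomial, up to
  -- powers of `x`.
  obtain ⟨m, rfl⟩ : ∃ m, v = m * t / x := ⟨x * v / t, by field_simp⟩
  obtain ⟨p, rfl⟩ : ∃ p, q = p * t / x ^ 2 := ⟨x ^ 2 * q / t, by field_simp⟩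
  have hrel : p ^ 2 - 4 * (m - 1) * (m ^ 2 * t - x ^ 2 * (m - 1)) = 0 := by
    field_simp at hode
    have : t ^ 2 * (p ^ 2 - 4 * (m - 1) * (m ^ 2 * t - x ^ 2 * (m - 1))) = 0 := by
      linear_combination t ^ 2 * hode
    exact (mul_eq_zero.1 this).resolve_left (pow_ne_zero 2 ht)
  have h0 : F = 1 + t - m := by rw [hF]; field_simp
  have h1 : x * F₁ = m * t - m - p + m ^ 2 := by rw [hF₁]; field_simp
  have h2 : x ^ 2 * F₂ = p * t - p
      - (2 * m ^ 2 * t + 4 * (m - 1) * m * t - 4 * (m - 1) * x ^ 2)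
      + p * m + 2 * m * (m + p - m ^ 2) := by
    rw [hF₂, hE]; field_simp; ring
  have key : x ^ 2 * (x ^ 2 * F₂ ^ 2 - 4 * (x * F₁ - F) * F₁ ^ 2 - 4 * F₁ ^ 2
      + 4 * (x * F₁ - F) ^ 2) = 0 := by
    have : x ^ 2 * (x ^ 2 * F₂ ^ 2 - 4 * (x * F₁ - F) * F₁ ^ 2 - 4 * F₁ ^ 2
      + 4 * (x * F₁ - F) ^ 2) = (x ^ 2 * F₂) ^ 2 - 4 * (x * F₁ - F) * (x * F₁) ^ 2
        - 4 * (x * F₁) ^ 2 + 4 * x ^ 2 * (x * F₁ - F) ^ 2 := by ring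
    rw [this, h2, h1, h0]
    linear_combination (4 * p + (t - 1 + 3 * m) ^ 2 + 4 * x ^ 2
      - 4 * ((m - 1) * t + m ^ 2 + 2 * (m * t - m + m ^ 2))) * hrel
  exact (mul_eq_zero.1 key).resolve_left (pow_ne_zero 2 hx)

/-! ### Behaviour near zero for `a = 0` -/

namespace IsScaledGapSolution

variable {b : ℝ} {τ : ℝ → ℝ}

theorem clairautDefect_nonneg (h : IsScaledGapSolution 0 b τ) {x : ℝ} (hx : x ∈ Set.Ioo 0 b) :
    0 ≤ clairautDefect τ x := by
  have := h.sq_deriv_clairautDefect hx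
  by_contra! hneg
  nlinarith [sq_nonneg (x * deriv (deriv τ) x), mul_pos_of_neg_of_neg hneg hneg,
    mul_nonneg (neg_pos.2 hneg).le (sq_nonneg (deriv τ x))]

theorem one_div_pi_le_div (h : IsScaledGapSolution 0 b τ) {x : ℝ} (hx : x ∈ Set.Ioo 0 b) :
    1 / Real.pi ≤ τ x / x := by
  have hm : MonotoneOn (fun y => τ y / y) (Set.Ioo 0 b) := by
    apply monotoneOn_of_deriv_nonneg (convex_Ioo 0 b)
    · exact fun y hy => (h.hasDerivAt_div_id hy).continuousAt.continuousWithinAt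
    · rw [interior_Ioo]
      exact fun y hy => (h.hasDerivAt_div_id hy).differentiableAt.differentiableWithinAt
    · rw [interior_Ioo]
      intro y hy
      rw [(h.hasDerivAt_div_id hy).deriv]
      exact div_nonneg (h.clairautDefect_nonneg hy) (sq_nonneg y)
  refine le_of_tendsto (isEquivalent_sigmaPVLeading_zero_iff.1 h.boundary) ?_
  filter_upwards [Ioo_mem_nhdsGT hx.1] with y hy
  exact hm ⟨hy.1, hy.2.trans hx.2⟩ hx hy.2.le

theorem pos (h : IsScaledGapSolution 0 b τ) {x : ℝ} (hx : x ∈ Set.Ioo 0 b) : 0 < τ x := by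
  have hπ : 0 < 1 / Real.pi := by positivity
  exact (div_pos_iff_of_pos_right hx.1).1 (hπ.trans_le (h.one_div_pi_le_div hx))

theorem deriv_pos (h : IsScaledGapSolution 0 b τ) {x : ℝ} (hx : x ∈ Set.Ioo 0 b) :
    0 < deriv τ x := by
  have hv : x * deriv τ x = clairautDefect τ x + τ x := by simp [clairautDefect]
  exact pos_of_mul_pos_right (hv ▸ by linarith [h.pos hx, h.clairautDefect_nonneg hx]) hx.1.le

/-- The inequality `u ≤ τ²` for `u = x τ' - τ`. Formally `|(√u)'| ≤ τ'`, so that `√u - τ` is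
decreasing; if it were positive somewhere, `u` would be bounded below down to `0`. -/
theorem clairautDefect_le_sq (h : IsScaledGapSolution 0 b τ) {x : ℝ} (hx : x ∈ Set.Ioo 0 b) :
    clairautDefect τ x ≤ τ x ^ 2 := by
  -- The square root is regularized by `ε`, since `u` might vanish.
  have hanti : ∀ ε > 0, AntitoneOn (fun y => √(clairautDefect τ y + ε) - τ y)
      (Set.Ioo 0 b) := by
    intro ε hε
    have hpos : ∀ y ∈ Set.Ioo 0 b, 0 < clairautDefect τ y + ε := fun y hy => by
      linarith [h.clairautDefect_nonneg hy]
    have hd : ∀ y ∈ Set.Ioo 0 b, HasDerivAt (fun y => √(clairautDefect τ y + ε) - τ y)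
        (y * deriv (deriv τ) y / (2 * √(clairautDefect τ y + ε)) - deriv τ y) y := fun y hy =>
      (((h.hasDerivAt_clairautDefect hy).add_const ε).sqrt (hpos y hy).ne').sub (h.hasDerivAt hy)
    apply antitoneOn_of_deriv_nonpos (convex_Ioo 0 b)
    · exact fun y hy => (hd y hy).continuousAt.continuousWithinAt
    · rw [interior_Ioo]
      exact fun y hy => (hd y hy).differentiableAt.differentiableWithinAt
    · rw [interior_Ioo]
      intro y hy
      have hs := Real.sqrt_pos.2 (hpos y hy)
      have hv := h.deriv_pos hy
      rw [(hd y hy).deriv, sub_nonpos, div_le_iff₀ (by positivity)]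
      apply le_of_abs_le
      apply abs_le_of_sq_le_sq _ (by positivity)
      rw [h.sq_deriv_clairautDefect hy, mul_pow, mul_pow, Real.sq_sqrt (hpos y hy).le]
      nlinarith [sq_nonneg (clairautDefect τ y), mul_pos hε (pow_pos hv 2)]
  by_contra! hlt
  have hτ := h.pos hx
  have hk : 0 < √(clairautDefect τ x) - τ x := sub_pos.2 (Real.lt_sqrt_of_sq_lt hlt)
  refine h.not_forall_le_clairautDefect (isEquivalent_sigmaPVLeading_zero_iff.1 h.boundary)
    hx.1 hx.2.le (pow_pos hk 2) fun y hy => le_of_forall_pos_le_add fun ε hε => ?_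
  have hyb : y ∈ Set.Ioo 0 b := ⟨hy.1, hy.2.trans hx.2⟩
  have h1 := hanti ε hε hyb hx hy.2.le
  simp only at h1
  have h2 : √(clairautDefect τ x) ≤ √(clairautDefect τ x + ε) :=
    Real.sqrt_le_sqrt (by linarith)
  have h3 : √(clairautDefect τ x) - τ x ≤ √(clairautDefect τ y + ε) := by
    linarith [h.pos hyb]
  calc _ ≤ √(clairautDefect τ y + ε) ^ 2 := pow_le_pow_left₀ hk.le h3 2
    _ = _ := Real.sq_sqrt (by linarith [h.clairautDefect_nonneg hyb])

/-- For `a = 0` the only affine solution is `x / π`. -/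
theorem exists_deriv_deriv_ne_zero_zero (h : IsScaledGapSolution 0 b τ)
    (hne : ∃ x ∈ Set.Ioo 0 b, τ x ≠ x / Real.pi) :
    ∃ x ∈ Set.Ioo 0 b, deriv (deriv τ) x ≠ 0 := by
  by_contra! h2
  obtain ⟨c, d, hcd⟩ := h.exists_affine_of_deriv_deriv_eq_zero h2
  obtain ⟨x, hx, hxne⟩ := hne
  have hbdy := isEquivalent_sigmaPVLeading_zero_iff.1 h.boundary
  have hev : ∀ᶠ y in 𝓝[>] (0 : ℝ), 0 < y ∧ τ y = c * y + d := by
    filter_upwards [Ioo_mem_nhdsGT (hx.1.trans hx.2)] with y hy using ⟨hy.1, hcd y hy⟩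
  have hτ0 : Tendsto τ (𝓝[>] 0) (𝓝 0) :=
    tendsto_zero_of_tendsto_div_pow one_ne_zero (by simpa using hbdy)
  have hd : d = 0 := by
    have h3 : Tendsto (fun y : ℝ => c * y + d) (𝓝[>] 0) (𝓝 d) := by
      simpa using (tendsto_const_mul_pow_nhdsGT_zero c one_ne_zero).add_const d
    exact tendsto_nhds_unique (h3.congr' (by
      filter_upwards [hev] with y hy using hy.2.symm)) hτ0
  have hc : c = 1 / Real.pi := tendsto_nhds_unique (tendsto_const_nhds.congr' (by
    filter_upwards [hev] with y hy
    rw [hy.2, hd, add_zero, mul_div_cancel_right₀ _ hy.1.ne'])) hbdy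
  apply hxne
  rw [hcd x hx, hc, hd]
  ring

/-- For a nonlinear solution with `a = 0`, the difference `H = τ² - (x τ' - τ)` satisfies
`H'' = 4 u - 2 (τ / x) H' + 4 τ' H / x`. Three integrations of this equation improve the bound
`H = O(x²)` to `H ~ x⁴ / (3π²)`. -/
theorem tendsto_sq_sub_clairautDefect_div (h : IsScaledGapSolution 0 b τ) (hb : 0 < b)
    (hlin : ∃ x ∈ Set.Ioo 0 b, deriv (deriv τ) x ≠ 0) :
    Tendsto (fun x => (τ x ^ 2 - clairautDefect τ x) / x ^ 4) (𝓝[>] 0)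
      (𝓝 ((1 / Real.pi) ^ 2 / 3)) := by
  have hbdy := isEquivalent_sigmaPVLeading_zero_iff.1 h.boundary
  have hπ := Real.pi_gt_three
  have hev : ∀ᶠ x in 𝓝[>] (0 : ℝ), τ x ≤ x := by
    filter_upwards [hbdy.eventually_lt_const (show 1 / Real.pi < (1 : ℝ) by
        rw [div_lt_one (by positivity)]; linarith), self_mem_nhdsWithin] with x h2 hx
    rw [div_lt_one hx] at h2
    exact h2.le
  obtain ⟨r, hr, hrb, hτ⟩ := exists_forall_Ioo_of_eventually (lt_min hb one_pos) hev
  have hr1 := hrb.trans (min_le_right _ _)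
  replace hrb := hrb.trans (min_le_left _ _)
  have hI : ∀ x ∈ Set.Ioo 0 r, x ∈ Set.Ioo 0 b := fun x hx => ⟨hx.1, hx.2.trans_le hrb⟩
  set u := clairautDefect τ
  set H : ℝ → ℝ := fun x => τ x ^ 2 - u x
  set H₁ : ℝ → ℝ := fun x => 2 * τ x * deriv τ x - x * deriv (deriv τ) x
  set H₂ : ℝ → ℝ := fun x => 4 * u x - 2 * (τ x / x) * H₁ x + 4 * (deriv τ x * (H x / x))
  have hH : ∀ x ∈ Set.Ioo 0 r, HasDerivAt H (H₁ x) x := fun x hx =>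
    (((h.hasDerivAt (hI x hx)).pow 2).sub
      (h.hasDerivAt_clairautDefect (hI x hx))).congr_deriv (by simp [H₁])
  have hH₁ : ∀ x ∈ Set.Ioo 0 r, HasDerivAt H₁ (H₂ x) x := by
    intro x hx
    have hx0 := hx.1.ne'
    refine ((((h.hasDerivAt (hI x hx)).const_mul 2).mul (h.hasDerivAt_deriv (hI x hx))).sub
      (h.hasDerivAt_mul_deriv_deriv hlin (hI x hx))).congr_deriv ?_
    simp only [H₂, H₁, H, u]
    field_simp
    ring
  have hτ0 : ∀ x ∈ Set.Ioo 0 r, 0 < τ x := fun x hx => h.pos (hI x hx)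
  have hu0 : ∀ x ∈ Set.Ioo 0 r, 0 ≤ u x := fun x hx => h.clairautDefect_nonneg (hI x hx)
  have hu : ∀ x ∈ Set.Ioo 0 r, u x ≤ x ^ 2 := fun x hx =>
    (h.clairautDefect_le_sq (hI x hx)).trans (pow_le_pow_left₀ (hτ0 x hx).le (hτ x hx) 2)
  have hv0 : ∀ x ∈ Set.Ioo 0 r, 0 < deriv τ x := fun x hx => h.deriv_pos (hI x hx)
  have hv : ∀ x ∈ Set.Ioo 0 r, deriv τ x ≤ 2 := by
    intro x hx
    have hx0 := hx.1
    have h1 : x * deriv τ x = u x + τ x := by simp [u, clairautDefect]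
    have : x * deriv τ x ≤ x * 2 := by
      nlinarith [hu x hx, hτ x hx, hx.2.trans_le hr1]
    exact le_of_mul_le_mul_left this hx0
  have hp : ∀ x ∈ Set.Ioo 0 r, |τ x / x| ≤ 1 := fun x hx => by
    rw [abs_of_pos (div_pos (hτ0 x hx) hx.1), div_le_one hx.1]
    exact hτ x hx
  have hHb : ∀ x ∈ Set.Ioo 0 r, |H x| ≤ x ^ 2 := fun x hx => by
    have h1 := h.clairautDefect_le_sq (hI x hx)
    have h2 := pow_le_pow_left₀ (hτ0 x hx).le (hτ x hx) 2
    have h3 := hu0 x hx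
    rw [abs_of_nonneg (sub_nonneg.2 h1)]
    linarith
  have hH₁b : ∀ x ∈ Set.Ioo 0 r, |H₁ x| ≤ 8 * x := by
    intro x hx
    have hx0 := hx.1
    have h1 : |x * deriv (deriv τ) x| ≤ 4 * x := by
      apply abs_le_of_sq_le_sq _ (by positivity)
      rw [h.sq_deriv_clairautDefect (hI x hx)]
      have h2 : deriv τ x ^ 2 ≤ 2 ^ 2 := pow_le_pow_left₀ (hv0 x hx).le (hv x hx) 2
      calc _ ≤ 4 * u x * deriv τ x ^ 2 := by nlinarith [sq_nonneg (u x)]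
        _ ≤ 4 * x ^ 2 * 2 ^ 2 := by
          have := hu x hx
          have := hu0 x hx
          gcongr
        _ = (4 * x) ^ 2 := by ring
    refine (abs_sub _ _).trans ?_
    rw [abs_of_pos (mul_pos (mul_pos two_pos (hτ0 x hx)) (hv0 x hx))]
    nlinarith [hτ0 x hx, hτ x hx, hv x hx, hv0 x hx]
  have hRb : ∀ n A B, (∀ x ∈ Set.Ioo 0 r, |H₁ x| ≤ A * x ^ n) →
      (∀ x ∈ Set.Ioo 0 r, |H x| ≤ B * x ^ (n + 1)) →
      ∀ x ∈ Set.Ioo 0 r, |H₂ x - 4 * u x| ≤ (2 * A + 8 * B) * x ^ n := by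
    intro n A B hA hB x hx
    have hx0 := hx.1
    have h1 : |H x / x| ≤ B * x ^ n := by
      rw [abs_div, abs_of_pos hx0, div_le_iff₀ hx0]
      exact (hB x hx).trans_eq (by ring)
    have h2 : |2 * (τ x / x) * H₁ x| ≤ 2 * 1 * (A * x ^ n) := by
      rw [abs_mul, abs_mul, abs_two]
      gcongr
      · exact hp x hx
      · exact hA x hx
    have h3 : |4 * (deriv τ x * (H x / x))| ≤ 4 * (2 * (B * x ^ n)) := by
      rw [abs_mul, abs_mul, abs_of_pos (hv0 x hx), abs_of_pos (by norm_num : (0 : ℝ) < 4)]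
      have := hv x hx
      gcongr
    rw [show H₂ x - 4 * u x = 4 * (deriv τ x * (H x / x)) - 2 * (τ x / x) * H₁ x by
      simp only [H₂]; ring]
    refine (abs_sub _ _).trans ?_
    linarith
  have hH0 : Tendsto H (𝓝[>] 0) (𝓝 0) := tendsto_zero_of_abs_le_mul hr (K := 1) fun x hx => by
    have := hHb x hx
    nlinarith [hx.1, hx.2.trans_le hr1]
  have hH₁0 : Tendsto H₁ (𝓝[>] 0) (𝓝 0) := tendsto_zero_of_abs_le_mul hr hH₁b
  -- A bound `O(xⁿ)` on `H''` gives `H' = O(xⁿ⁺¹)` and `H = O(xⁿ⁺²)`.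
  have hstep : ∀ (n : ℕ) (A : ℝ), 0 ≤ A → (∀ x ∈ Set.Ioo 0 r, |H₂ x| ≤ A * x ^ n) →
      (∀ x ∈ Set.Ioo 0 r, |H₁ x| ≤ A * x ^ (n + 1)) ∧
      ∀ x ∈ Set.Ioo 0 r, |H x| ≤ A * x ^ (n + 1 + 1) := by
    have hdiv : ∀ (n : ℕ) (A : ℝ), 0 ≤ A → A / (n + 1) ≤ A := fun n A hA =>
      div_le_self hA (by simp)
    intro n A hA h2
    have h1 : ∀ x ∈ Set.Ioo 0 r, |H₁ x| ≤ A * x ^ (n + 1) := fun x hx =>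
      (abs_le_of_abs_deriv_le_pow hH₁ hH₁0 h2 x hx).trans
        (mul_le_mul_of_nonneg_right (hdiv n A hA) (pow_nonneg hx.1.le _))
    exact ⟨h1, fun x hx => (abs_le_of_abs_deriv_le_pow hH hH0 h1 x hx).trans
      (mul_le_mul_of_nonneg_right (hdiv _ A hA) (pow_nonneg hx.1.le _))⟩
  have hH₂b : ∀ x ∈ Set.Ioo 0 r, |H₂ x| ≤ 28 * x ^ 1 := by
    intro x hx
    have h1 := hRb 1 8 1 (by simpa using hH₁b) (by simpa using hHb) x hx
    have h2 := abs_add_le (H₂ x - 4 * u x) (4 * u x)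
    rw [sub_add_cancel, abs_of_nonneg (mul_nonneg (by norm_num) (hu0 x hx) : 0 ≤ 4 * u x)] at h2
    nlinarith [hu x hx, hx.1, hx.2.trans_le hr1]
  obtain ⟨hA1, hA2⟩ := hstep 1 28 (by norm_num) hH₂b
  have hH₂b' : ∀ x ∈ Set.Ioo 0 r, |H₂ x| ≤ 284 * x ^ 2 := by
    intro x hx
    have h1 := hRb 2 28 28 hA1 hA2 x hx
    have h2 := abs_add_le (H₂ x - 4 * u x) (4 * u x)
    rw [sub_add_cancel, abs_of_nonneg (mul_nonneg (by norm_num) (hu0 x hx) : 0 ≤ 4 * u x)] at h2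
    linarith [hu x hx]
  obtain ⟨hB1, hB2⟩ := hstep 2 284 (by norm_num) hH₂b'
  have hlim : Tendsto (fun x => H₂ x / (12 * x ^ 2)) (𝓝[>] 0)
      (𝓝 ((1 / Real.pi) ^ 2 / 3)) := by
    have h1 : Tendsto (fun x => H₂ x / (12 * x ^ 2) - (τ x / x) ^ 2 / 3) (𝓝[>] 0) (𝓝 0) := by
      apply tendsto_zero_of_abs_le_mul hr (K := 3976)
      intro x hx
      have hx0 := hx.1
      have h3 := hRb 3 284 284 hB1 hB2 x hx
      have h4 := hB2 x hx
      have h5 : x ^ 4 ≤ x ^ 3 :=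
        pow_le_pow_of_le_one hx0.le (hx.2.le.trans hr1) (by norm_num)
      rw [show H₂ x / (12 * x ^ 2) - (τ x / x) ^ 2 / 3 =
        ((H₂ x - 4 * u x) - 4 * H x) / (12 * x ^ 2) by simp only [H]; field_simp; ring,
        abs_div, abs_of_pos (by positivity : 0 < 12 * x ^ 2), div_le_iff₀ (by positivity)]
      refine (abs_sub _ _).trans ?_
      rw [abs_mul, abs_of_pos (by norm_num : (0 : ℝ) < 4)]
      norm_num at h3 h4
      nlinarith [pow_pos hx0 3]
    simpa using h1.add ((hbdy.pow 2).div_const 3)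
  have hmem := Ioo_mem_nhdsGT hr
  have hlim₁ : Tendsto (fun x => H₁ x / (4 * x ^ 3)) (𝓝[>] 0) (𝓝 ((1 / Real.pi) ^ 2 / 3)) := by
    refine HasDerivAt.lhopital_zero_nhdsGT (f' := H₂) (g' := fun x => 12 * x ^ 2)
      (by filter_upwards [hmem] with x hx using hH₁ x hx)
      (Eventually.of_forall fun x => ((hasDerivAt_pow 3 x).const_mul 4).congr_deriv
        (by norm_num; ring)) ?_ hH₁0 (tendsto_const_mul_pow_nhdsGT_zero 4 three_ne_zero) hlim
    filter_upwards [hmem] with x hx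
    have := hx.1
    positivity
  refine HasDerivAt.lhopital_zero_nhdsGT (f' := H₁) (g' := fun x => 4 * x ^ 3)
      (by filter_upwards [hmem] with x hx using hH x hx)
      (Eventually.of_forall fun x => (hasDerivAt_pow 4 x).congr_deriv
        (by norm_num)) ?_ hH0
      (by simpa using tendsto_const_mul_pow_nhdsGT_zero 1 four_ne_zero) hlim₁
  filter_upwards [hmem] with x hx
  have := hx.1
  positivity

/-! ### Conclusion -/

/-- The Bäcklund transformation maps a nonlinear solution with `a = 0` to a solution with
`a = 1`. -/
theorem backlund (h : IsScaledGapSolution 0 b τ) (hb : 0 < b)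
    (hlin : ∃ x ∈ Set.Ioo 0 b, deriv (deriv τ) x ≠ 0) :
    IsScaledGapSolution 1 b (fun x => 1 + τ x - x * (deriv τ x / τ x)) where
  analytic := (analyticOnNhd_const.add h.analytic).sub
    (analyticOnNhd_id.mul (h.analytic.deriv.div h.analytic fun _ hx => (h.pos hx).ne'))
  ode := by
    set F : ℝ → ℝ := fun x => 1 + τ x - x * (deriv τ x / τ x) with hF
    set F₁ : ℝ → ℝ := fun x => deriv τ x - deriv τ x / τ x - x * deriv (deriv τ) x / τ x
      + x * deriv τ x ^ 2 / τ x ^ 2 with hF₁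
    have hd : ∀ x ∈ Set.Ioo 0 b, HasDerivAt F (F₁ x) x := by
      intro x hx
      have ht := (h.pos hx).ne'
      refine (((h.hasDerivAt hx).const_add 1).sub ((hasDerivAt_id x).mul
        ((h.hasDerivAt_deriv hx).div (h.hasDerivAt hx) ht))).congr_deriv ?_
      simp only [hF₁, id, Pi.div_apply]
      field_simp
      ring
    intro x hx
    have ht := (h.pos hx).ne'
    have hd2 := (((h.hasDerivAt_deriv hx).sub
      ((h.hasDerivAt_deriv hx).div (h.hasDerivAt hx) ht)).sub
      ((h.hasDerivAt_mul_deriv_deriv hlin hx).div (h.hasDerivAt hx) ht)).add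
      (((hasDerivAt_id x).mul ((h.hasDerivAt_deriv hx).pow 2)).div
        ((h.hasDerivAt hx).pow 2) (pow_ne_zero 2 ht))
    have hd2' : HasDerivAt (deriv F) _ x := hd2.congr_of_eventuallyEq (by
      filter_upwards [isOpen_Ioo.mem_nhds hx] with y hy
      simpa using (hd y hy).deriv)
    have key := backlund_identity hx.1.ne' ht
      (show _ = 2 * deriv τ x ^ 2 + 4 * (x * deriv τ x - τ x) * deriv τ x / x
        - 4 * (x * deriv τ x - τ x) from rfl)
      (by simpa [clairautDefect] using h.sq_deriv_clairautDefect hx)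
      (show F x = _ from rfl) (hd x hx).deriv (F₂ := deriv (deriv F) x) (by
        rw [hd2'.deriv]
        simp only [clairautDefect, id, Pi.mul_apply, Pi.pow_apply]
        field_simp
        ring)
    simp only [sigmaPVLhs]
    linear_combination key
  boundary := by
    rw [isEquivalent_sigmaPVLeading_one_iff]
    have hbdy := isEquivalent_sigmaPVLeading_zero_iff.1 h.boundary
    have hπ := Real.pi_pos.ne'
    have h1 := (h.tendsto_sq_sub_clairautDefect_div hb hlin).div hbdy (by positivity)
    rw [show (1 / Real.pi) ^ 2 / 3 / (1 / Real.pi) = 1 / (3 * Real.pi) by field_simp] at h1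
    refine h1.congr' ?_
    filter_upwards [Ioo_mem_nhdsGT hb] with x hx
    have ht := (h.pos hx).ne'
    have hx0 := hx.1.ne'
    simp only [Pi.div_apply, clairautDefect]
    field_simp
    ring

end IsScaledGapSolution

theorem proposition9 (b : ℝ) (τ₀ τ₁ : ℝ → ℝ)
    (h₀ : IsScaledGapSolution 0 b τ₀)
    (h₁ : IsScaledGapSolution 1 b τ₁)
    (hne : ∃ x ∈ Set.Ioo 0 b, τ₀ x ≠ x / Real.pi) :
    ∀ x ∈ Set.Ioo 0 b,
      τ₀ x ≠ 0 ∧ τ₁ x = 1 + τ₀ x - x * (deriv τ₀ x / τ₀ x) := by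
  intro x hx
  exact ⟨(h₀.pos hx).ne', h₁.eqOn_of_one
    (h₀.backlund (hx.1.trans hx.2) (h₀.exists_deriv_deriv_ne_zero_zero hne)) hx⟩
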